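/- Let $w,s,h,m_1,\dots,m_s$ be positive integers with $w<h+m_1+\cdots+m_s$, and let $W$ be a set of $w$ wagons. A position is a sequence $p=(W_0,W_1,\dots,W_s)$ of pairwise disjoint ordered subsets of $W$ (finite sequences of distinct wagons) whose union is $W$, with $|W_0|\le h$ and $|W_i|\le m_i$ for $1\le i\le s$. Here $W_0$ lists the wagons in the headshunt from the shunting engine to the points, and $W_i$ lists the wagons in Siding $i$ from the points to the buffer stop. The inglenook graph has the positions as vertices; two distinct positions $(W_0,\dots,W_s)$ and $(W'_0,\dots,W'_s)$ are adjacent (form a move) if and only if for some $r\in\{1,\dots,s\}$ we have $W_i=W'_i$ for all $i\in\{1,\dots,s\}\setminus\{r\}$ and the concatenation of $W_0$ and $W_r$ equals the concatenation of $W'_0$ and $W'_r$. Let $S$ and $F$ be nonempty sets of positions (the starting and finishing positions) that are natural, meaning that 1. $S$ is closed under permuting the wagons: if $p\in S$, then every position obtained from $p$ by applying a permutation of $W$ to the wagons also lies in $S$; 2. there are $z\in\{1,\dots,s\}$ and $\omega\in W$ such that in every position of $F$ the last wagon (nearest the buffer stop) of Siding $z$ is $\omega$. The puzzle can always be solved if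 from every $p\in S$ there is a path in the inglenook graph to some position in $F$. Consider the inequality $$h-1+m_1+m_2+\cdots+m_s\ \ge\ w+\max\{h-1,m_1,m_2,\dots,m_s\}.\qquad(*)$$ **Theorem.** The puzzle can always be solved if and only if one of the following holds: - $w=1$; - $w>1$, $s>1$, $h>1$ and $(*)$; - $w>1$, $s>2$, $h=1$ and $(*)$. -/

import Mathlib

namespace Inglenook

/-- A position `(W₀, W₁, …, W_s)` of the inglenook puzzle with set of wagons `W`, headshunt length `h`
and `s` sidings of lengths `m 0, …, m (s - 1)`. Ordered subsets of `W` are lists without repetition.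
The headshunt is listed from the shunting engine to the points, each siding from the points to the
buffer stop. -/
@[ext]
structure Position (W : Type*) {s : ℕ} (h : ℕ) (m : Fin s → ℕ) where
  /-- the wagons in the headshunt, from shunting engine to points -/
  headshunt : List W
  /-- the wagons in each siding, from points to buffer stop -/
  siding : Fin s → List W
  headshunt_nodup : headshunt.Nodup
  siding_nodup : ∀ i, (siding i).Nodup
  /-- every wagon is in the headshunt or in a siding -/
  cover : ∀ a : W, a ∈ headshunt ∨ ∃ i, a ∈ siding i
  headshunt_disjoint : ∀ i, List.Disjoint headshunt (siding i)
  siding_disjoint : ∀ i j, i ≠ j → List.Disjoint (siding i) (siding j)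
  headshunt_length_le : headshunt.length ≤ h
  siding_length_le : ∀ i, (siding i).length ≤ m i

variable {W : Type*} {s : ℕ} {h : ℕ} {m : Fin s → ℕ}

/-- The pair `(p, q)` is a move: the positions are distinct and, for some siding `r`, all other
sidings agree and the headshunt followed by siding `r` is the same list of wagons in `p` and `q`. -/
def IsMove (p q : Position W h m) : Prop :=
  p ≠ q ∧ ∃ r : Fin s, (∀ i, i ≠ r → p.siding i = q.siding i) ∧
    p.headshunt ++ p.siding r = q.headshunt ++ q.siding r

theorem IsMove.symm {p q : Position W h m} (hpq : IsMove p q) : IsMove q p := by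
  obtain ⟨hne, r, h1, h2⟩ := hpq
  exact ⟨hne.symm, r, fun i hi => (h1 i hi).symm, h2.symm⟩

/-- The inglenook graph: vertices are the positions, edges are the moves. -/
def graph (W : Type*) {s : ℕ} (h : ℕ) (m : Fin s → ℕ) : SimpleGraph (Position W h m) where
  Adj := IsMove
  symm := ⟨fun _ _ hpq => hpq.symm⟩
  loopless := ⟨fun _ hp => hp.1 rfl⟩

/-- The position obtained from `p` by permuting the wagons amongst themselves. -/
def Position.permute (σ : Equiv.Perm W) (p : Position W h m) : Position W h m where
  headshunt := p.headshunt.map σ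
  siding i := (p.siding i).map σ
  headshunt_nodup := p.headshunt_nodup.map σ.injective
  siding_nodup i := (p.siding_nodup i).map σ.injective
  cover a := by
    rcases p.cover (σ.symm a) with ha | ⟨i, ha⟩
    · exact Or.inl (List.mem_map.2 ⟨_, ha, σ.apply_symm_apply a⟩)
    · exact Or.inr ⟨i, List.mem_map.2 ⟨_, ha, σ.apply_symm_apply a⟩⟩
  headshunt_disjoint i := List.disjoint_map σ.injective (p.headshunt_disjoint i)
  siding_disjoint i j hij := List.disjoint_map σ.injective (p.siding_disjoint i j hij)
  headshunt_length_le := by simpa using p.headshunt_length_le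
  siding_length_le i := by simpa using p.siding_length_le i

/-- A set of starting positions is natural if it is closed under permuting the wagons. -/
def IsNaturalStart (S : Set (Position W h m)) : Prop :=
  ∀ p ∈ S, ∀ σ : Equiv.Perm W, p.permute σ ∈ S

/-- A set of finishing positions is natural if, for some siding `z`, all its positions have the same
wagon as the last wagon (nearest the buffer stop) in siding `z`. -/
def IsNaturalFinish (F : Set (Position W h m)) : Prop :=
  ∃ (z : Fin s) (ω : W), ∀ p ∈ F, (p.siding z).getLast? = some ω

/-- The puzzle with starting positions `S` and finishing positions `F` can always be solved: from
every starting position there is a path in the inglenook graph to a finishing position. -/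
def AlwaysSolvable (S F : Set (Position W h m)) : Prop :=
  ∀ p ∈ S, ∃ q ∈ F, (graph W h m).Reachable p q

/-- The inequality `h - 1 + m₁ + ⋯ + m_s ≥ w + max {h - 1, m₁, …, m_s}` (used only for `1 ≤ h`). -/
def MainCondition {s : ℕ} (w h : ℕ) (m : Fin s → ℕ) : Prop :=
  (h - 1) + ∑ i, m i ≥ w + max (h - 1) (Finset.univ.sup m)

end Inglenook

/-!
A headshunt with one vacant place lets the last wagon of the headshunt or the first wagon of a
siding be moved to the points end of any other track: pull it into the headshunt, then push it out.
So the tracks behave like stacks of capacities `h - 1, m₁, …, m_s` between which single elements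
travel freely. If all elements fit outside any one stack, then a largest stack can be emptied and,
using a third stack as a parking place, any prescribed element can be brought to its bottom. That
element is then left alone, and induction on the number of elements shows that all arrangements are
connected.

Conversely, whenever one of the conditions fails some wagon is pinned: the wagon next to the engine,
or the last wagon of the headshunt followed by some siding, or an end of the whole line of wagons
never changes. Since the starting positions are closed under permutations, the pinned wagon can be
chosen at will, in conflict with the prescribed last wagon `ω` of siding `z`.
-/

namespace Inglenook

open Function
open scoped Finset

section Stacks

variable {ι W : Type*} {c : ι → ℕ} {T T' : ι → List W}

/-- The stacks `T`, each listed from the top, respect the capacities `c`. -/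
def Fits (c : ι → ℕ) (T : ι → List W) : Prop :=
  ∀ k, (T k).length ≤ c k

/-- The multiset of all elements of the stacks `T`. -/
def content [Fintype ι] (T : ι → List W) : Multiset W :=
  ∑ i, (T i : Multiset W)

theorem card_content [Fintype ι] (T : ι → List W) :
    (content T).card = ∑ i, (T i).length := by
  simp [content]

theorem mem_content [Fintype ι] {a : W} : a ∈ content T ↔ ∃ i, a ∈ T i := by
  simp [content, Multiset.mem_sum]

theorem count_content [Fintype ι] [DecidableEq W] (T : ι → List W) (a : W) :
    (content T).count a = ∑ i, (T i).count a := by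
  simp [content, Multiset.count_sum']

theorem eq_nil_of_content_eq_zero [Fintype ι] (hT : content T = 0) : T = fun _ => [] :=
  funext fun i => List.eq_nil_iff_forall_not_mem.2 fun _ ha =>
    Multiset.notMem_zero _ (hT ▸ mem_content.2 ⟨i, ha⟩)

/-- The capacities `c` leave enough room to rearrange `w` elements arbitrarily: the elements fit
outside any one stack, and, unless there is at most one element, at least three stacks can hold
something. -/
structure Roomy [Fintype ι] (c : ι → ℕ) (w : ℕ) : Prop where
  add_le_sum : ∀ j, w + c j ≤ ∑ i, c i
  two_lt_card : 2 ≤ w → 2 < #{k | 0 < c k}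

theorem Roomy.exists_third_stack [Fintype ι] {w : ℕ} (hc : Roomy c w) (hw : 2 ≤ w) (i j : ι) :
    ∃ k, k ≠ i ∧ k ≠ j ∧ 0 < c k := by
  classical
  obtain ⟨k, hk, hkij⟩ := Finset.exists_mem_notMem_of_card_lt_card
    ((Finset.card_le_two (a := i) (b := j)).trans_lt (hc.two_lt_card hw))
  simp only [Finset.mem_insert, Finset.mem_singleton, not_or] at hkij
  exact ⟨k, hkij.1, hkij.2, (Finset.mem_filter.1 hk).2⟩

variable [DecidableEq ι]

/-- The stacks `T` after putting `a` on top of stack `i`. -/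
def push (T : ι → List W) (i : ι) (a : W) : ι → List W :=
  update T i (a :: T i)

/-- The stacks `T` after putting `a` underneath stack `i`. -/
def pushBottom (T : ι → List W) (i : ι) (a : W) : ι → List W :=
  update T i (T i ++ [a])

theorem length_push (T : ι → List W) (i : ι) (a : W) (k : ι) :
    (push T i a k).length = (T k).length + (Pi.single i 1 : ι → ℕ) k := by
  rcases eq_or_ne k i with rfl | hk <;> simp [push, *]

theorem length_pushBottom (T : ι → List W) (i : ι) (a : W) (k : ι) :
    (pushBottom T i a k).length = (T k).length + (Pi.single i 1 : ι → ℕ) k := by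
  rcases eq_or_ne k i with rfl | hk <;> simp [pushBottom, *]

theorem length_le_length_push (T : ι → List W) (i : ι) (a : W) (k : ι) :
    (T k).length ≤ (push T i a k).length :=
  length_push T i a k ▸ Nat.le_add_right _ _

theorem fits_pushBottom_iff {i : ι} {a : W} :
    Fits (c + Pi.single i 1) (pushBottom T i a) ↔ Fits c T := by
  simp only [Fits, length_pushBottom, Pi.add_apply, add_le_add_iff_right]

theorem content_push [Fintype ι] (T : ι → List W) (i : ι) (a : W) :
    content (push T i a) = a ::ₘ content T := by
  have hpush (k : ι) :
      (push T i a k : Multiset W) = (Pi.single i {a} : ι → Multiset W) k + T k := by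
    rcases eq_or_ne k i with rfl | hk
    · simp [push, ← Multiset.cons_coe]
    · simp [push, hk]
  simp [content, hpush, Finset.sum_add_distrib]

theorem content_pushBottom [Fintype ι] (T : ι → List W) (i : ι) (a : W) :
    content (pushBottom T i a) = a ::ₘ content T := by
  rw [← content_push T i a]
  refine Finset.sum_congr rfl fun k _ => ?_
  rcases eq_or_ne k i with rfl | hk <;> simp [push, pushBottom, *]

theorem push_pushBottom (T : ι → List W) (i z : ι) (a ω : W) :
    push (pushBottom T z ω) i a = pushBottom (push T i a) z ω := by
  rcases eq_or_ne i z with rfl | hiz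
  · simp [push, pushBottom]
  · simp only [push, pushBottom, update_of_ne hiz, update_of_ne hiz.symm, update_comm hiz]

theorem exists_eq_add_single {z : ι} (hz : 0 < c z) : ∃ d : ι → ℕ, c = d + Pi.single z 1 :=
  le_iff_exists_add'.1 (update_le_iff.2 ⟨hz, fun _ _ => Nat.zero_le _⟩)

theorem push_update_of_eq_cons {i : ι} {a : W} {l : List W} (hi : T i = a :: l) :
    push (update T i l) i a = T := by
  simp [push, ← hi]

theorem pushBottom_update_of_eq_singleton {i : ι} {a : W} (hi : T i = [a]) :
    pushBottom (update T i []) i a = T := by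
  simp [pushBottom, ← hi]

theorem exists_eq_push_of_content_eq_singleton [Fintype ι] {a : W} (hT : content T = {a}) :
    ∃ i, T = push (fun _ => []) i a := by
  obtain ⟨i, hi⟩ := mem_content.1 (hT ▸ Multiset.mem_singleton_self a)
  obtain ⟨b, l, hbl⟩ := List.exists_cons_of_ne_nil (List.ne_nil_of_mem hi)
  rw [← push_update_of_eq_cons hbl, content_push] at hT
  obtain rfl : b = a := Multiset.mem_singleton.1 (hT ▸ Multiset.mem_cons_self b _)
  have hnil : content (update T i l) = 0 := (Multiset.cons_inj_right b).1 hT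
  exact ⟨i, by rw [← eq_nil_of_content_eq_zero hnil, push_update_of_eq_cons hbl]⟩

/-- `T'` arises from `T` by moving the top element `a` of one stack to the top of a stack, within
the capacities `c`. Both are described by what remains without `a`, which makes the relation visibly
symmetric. -/
def StackStep (c : ι → ℕ) (T T' : ι → List W) : Prop :=
  Fits c T ∧ Fits c T' ∧ ∃ (U : ι → List W) (i j : ι) (a : W), T = push U i a ∧ T' = push U j a

/-- Reachability by moves of single elements between stacks of capacities `c`. -/
abbrev StackReach (c : ι → ℕ) : (ι → List W) → (ι → List W) → Prop :=
  Relation.ReflTransGen (StackStep c)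

theorem StackStep.symm (hstep : StackStep c T T') : StackStep c T' T :=
  let ⟨hT, hT', U, i, j, a, hi, hj⟩ := hstep
  ⟨hT', hT, U, j, i, a, hj, hi⟩

theorem StackReach.symm (hr : StackReach c T T') : StackReach c T' T :=
  have : Std.Symm (StackStep (W := W) c) := ⟨fun _ _ => StackStep.symm⟩
  Std.Symm.symm _ _ hr

theorem StackReach.fits (hr : StackReach c T T') (hT : Fits c T) : Fits c T' := by
  cases hr with
  | refl => exact hT
  | tail _ hstep => exact hstep.2.1

theorem StackStep.content_eq [Fintype ι] (hstep : StackStep c T T') : content T = content T' := by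
  obtain ⟨-, -, U, i, j, a, rfl, rfl⟩ := hstep
  rw [content_push, content_push]

theorem StackReach.content_eq [Fintype ι] (hr : StackReach c T T') : content T = content T' := by
  induction hr with
  | refl => rfl
  | tail _ hstep ih => exact ih.trans hstep.content_eq

theorem StackReach.pushBottom (z : ι) (ω : W) (hr : StackReach c T T') :
    StackReach (c + Pi.single z 1) (pushBottom T z ω) (pushBottom T' z ω) := by
  refine hr.lift (Inglenook.pushBottom · z ω) ?_
  rintro _ _ ⟨hT, hT', U, i, j, a, rfl, rfl⟩
  exact ⟨fits_pushBottom_iff.2 hT, fits_pushBottom_iff.2 hT', Inglenook.pushBottom U z ω, i, j, a,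
    (push_pushBottom U i z a ω).symm, (push_pushBottom U j z a ω).symm⟩

theorem Fits.stackStep_of_eq_cons (hT : Fits c T) {i j : ι} (hij : i ≠ j) {a : W} {l : List W}
    (hi : T i = a :: l) (hj : (T j).length < c j) :
    StackStep c T (update (update T i l) j (a :: T j)) := by
  have hpush : push (update T i l) j a = update (update T i l) j (a :: T j) := by
    simp [push, hij.symm]
  refine ⟨hT, fun k => ?_, update T i l, i, j, a, (push_update_of_eq_cons hi).symm, hpush.symm⟩
  rcases eq_or_ne k j with rfl | hkj
  · simpa using hj
  have hk := hT k
  rcases eq_or_ne k i with rfl | hki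
  · rw [hi, List.length_cons] at hk
    simpa [hkj] using (Nat.le_succ _).trans hk
  · simpa [hkj, hki] using hk

theorem Fits.stackReach_of_eq_append (hT : Fits c T) {i j : ι} (hij : i ≠ j) {L X : List W}
    (hi : T i = L ++ X) (hj : L.length + (T j).length ≤ c j) :
    StackReach c T (update (update T i X) j (L.reverse ++ T j)) := by
  induction L generalizing T with
  | nil =>
    rw [show X = T i from hi.symm]
    simpa using Relation.ReflTransGen.refl
  | cons a L ih =>
    rw [List.length_cons] at hj
    have hstep := hT.stackStep_of_eq_cons hij hi (by omega)
    have hrest := ih hstep.2.1 (by simp [hij]) (by simp; omega)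
    simpa [update_comm hij] using hrest.head hstep

theorem Fits.exists_stackReach_eq_nil [Fintype ι] (z : ι) (hT : Fits c T)
    (hc : (content T).card + c z ≤ ∑ i, c i) : ∃ T', StackReach c T T' ∧ T' z = [] := by
  induction hl : T z generalizing T with
  | nil => exact ⟨T, .refl, hl⟩
  | cons a l ih =>
    obtain ⟨j, hjz, hj⟩ : ∃ j, j ≠ z ∧ (T j).length < c j := by
      by_contra! hfull
      rw [card_content, ← Finset.add_sum_erase _ _ (Finset.mem_univ z),
        ← Finset.add_sum_erase _ c (Finset.mem_univ z), hl, List.length_cons] at hc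
      have := Finset.sum_le_sum (s := Finset.univ.erase z)
        fun j hj => hfull j (Finset.ne_of_mem_erase hj)
      omega
    have hstep := hT.stackStep_of_eq_cons hjz.symm hl hj
    obtain ⟨T', hr, hz⟩ := ih hstep.2.1 (hstep.content_eq ▸ hc) (by simp [hjz.symm])
    exact ⟨T', hr.head hstep, hz⟩

theorem Fits.exists_stackReach_length_lt (hT : Fits c T) {j k : ι} (hkj : k ≠ j)
    (hj : (T j).length < c j) (hk : 0 < c k) :
    ∃ T', StackReach c T T' ∧ (T' k).length < c k ∧ (T' j).length ≤ (T j).length + 1 ∧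
      ∀ i, i ≠ j → i ≠ k → T' i = T i := by
  rcases (hT k).lt_or_eq with hlt | hfull
  · exact ⟨T, .refl, hlt, Nat.le_succ _, fun _ _ _ => rfl⟩
  · obtain ⟨b, Y, hY⟩ := List.exists_cons_of_length_pos (hfull ▸ hk)
    refine ⟨_, .single (hT.stackStep_of_eq_cons hkj hY hj), ?_, by simp, fun i hij hik => ?_⟩
    · simp [hkj, ← hfull, hY]
    · simp [hij, hik]

/-- The element `ω` waits on stack `k` while the rest of stack `z` moves to stack `j`. -/
theorem Fits.exists_stackReach_eq_singleton_of_eq_cons (hT : Fits c T) {z j k : ι} (hjz : j ≠ z)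
    (hkz : k ≠ z) (hkj : k ≠ j) {ω : W} {L : List W} (hz : T z = ω :: L)
    (hk : (T k).length < c k) (hj : L.length + (T j).length ≤ c j) :
    ∃ T', StackReach c T T' ∧ T' z = [ω] := by
  have hcz : 0 < c z := Nat.zero_lt_of_lt (by simpa [hz] using hT z)
  have park := hT.stackStep_of_eq_cons hkz.symm hz hk
  have clear := park.2.1.stackReach_of_eq_append hjz.symm (L := L) (X := [])
    (by simp [hkz.symm]) (by simpa [hkj.symm, hjz] using hj)
  have unpark := (clear.fits park.2.1).stackStep_of_eq_cons hkz (a := ω) (l := T k)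
    (by simp [hkj, hkz]) (by simpa [hjz.symm] using hcz)
  exact ⟨_, (clear.head park).tail unpark, by simp [hjz.symm]⟩

theorem Roomy.of_add_single [Fintype ι] {w : ℕ} {z : ι} (hc : Roomy (c + Pi.single z 1) (w + 1))
    (hz : ∀ k, c k ≤ c z + 1) : Roomy c w := by
  have hsum : ∑ i, (c + Pi.single z 1 : ι → ℕ) i = ∑ i, c i + 1 := by
    simp [Finset.sum_add_distrib]
  have hle (j : ι) : w + c j ≤ ∑ i, c i := by
    have := hc.add_le_sum j
    rw [hsum, Pi.add_apply] at this
    omega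
  refine ⟨hle, fun hw => ?_⟩
  rcases Nat.eq_zero_or_pos (c z) with hz0 | hzpos
  · -- All capacities in `c` are at most one, so `∑ i, c i` counts the usable stacks.
    have hcount : ∑ i, c i ≤ #{k | 0 < c k} := by
      rw [Finset.card_filter]
      refine Finset.sum_le_sum fun k _ => ?_
      have := hz k
      split_ifs <;> omega
    have := hc.add_le_sum z
    rw [hsum, Pi.add_apply, Pi.single_eq_same] at this
    omega
  · have hpos (k : ι) : 0 < (c + Pi.single z 1 : ι → ℕ) k ↔ 0 < c k := by
      rcases eq_or_ne k z with rfl | hk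
      · simp [hzpos]
      · simp [hk]
    simpa only [hpos] using hc.two_lt_card (by omega)

theorem Fits.exists_stackReach_eq_singleton [Fintype ι] (hT : Fits c T)
    (hc : Roomy c (content T).card) {z : ι} (hz : ∀ k, c k ≤ c z) {ω : W} (hω : ω ∈ content T) :
    ∃ T', StackReach c T T' ∧ T' z = [ω] := by
  obtain ⟨T₀, hr₀, hz₀⟩ := hT.exists_stackReach_eq_nil z (hc.add_le_sum z)
  have hT₀ := hr₀.fits hT
  obtain ⟨j, hj⟩ := mem_content.1 (hr₀.content_eq ▸ hω)
  have hjz : j ≠ z := by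
    rintro rfl
    simp [hz₀] at hj
  obtain ⟨L, X, hLX⟩ := List.append_of_mem hj
  have hlen : L.length + (X.length + 1) ≤ c j := by simpa [hLX] using hT₀ j
  have hzj := hz j
  -- Pouring `L` and `ω` into the empty stack `z` brings `ω` to its top.
  have pour := hT₀.stackReach_of_eq_append hjz (L := L ++ [ω]) (X := X) (by simp [hLX])
    (by simp [hz₀]; omega)
  set T₁ := update (update T₀ j X) z ((L ++ [ω]).reverse ++ T₀ z)
  have hz₁ : T₁ z = ω :: L.reverse := by simp [T₁, hz₀]
  have hj₁ : T₁ j = X := by simp [T₁, hjz]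
  rcases L.eq_nil_or_concat with rfl | ⟨L', b, hL'⟩
  · exact ⟨T₁, hr₀.trans pour, hz₁⟩
  have hLpos : 0 < L.length := by simp [hL']
  have htwo : 2 ≤ (content T).card := by
    have hj_le := Finset.single_le_sum (fun i _ => Nat.zero_le (T₀ i).length) (Finset.mem_univ j)
    rw [← card_content, hLX, List.length_append, List.length_cons] at hj_le
    rw [hr₀.content_eq]
    omega
  obtain ⟨k, hkz, hkj, hk⟩ := hc.exists_third_stack htwo z j
  have hT₁ := pour.fits hT₀
  obtain ⟨T₂, hr₂, hk₂, hj₂, hrest⟩ := hT₁.exists_stackReach_length_lt hkj (by rw [hj₁]; omega) hk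
  obtain ⟨T₃, hr₃, hz₃⟩ := (hr₂.fits hT₁).exists_stackReach_eq_singleton_of_eq_cons hjz hkz hkj
    ((hrest z hjz.symm hkz.symm).trans hz₁) hk₂ (by rw [hj₁] at hj₂; simp; omega)
  exact ⟨T₃, hr₀.trans (pour.trans (hr₂.trans hr₃)), hz₃⟩

theorem Fits.exists_stackReach_pushBottom [Fintype ι] {z : ι} (hT : Fits (c + Pi.single z 1) T)
    (hc : Roomy (c + Pi.single z 1) (content T).card) (hz : ∀ k, c k ≤ c z + 1) {ω : W}
    (hω : ω ∈ content T) :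
    ∃ U, Fits c U ∧ StackReach (c + Pi.single z 1) T (pushBottom U z ω) := by
  have hmax (k : ι) : (c + Pi.single z 1 : ι → ℕ) k ≤ (c + Pi.single z 1 : ι → ℕ) z := by
    rcases eq_or_ne k z with rfl | hk
    · rfl
    · simpa [hk] using hz k
  obtain ⟨T', hr, hT'⟩ := hT.exists_stackReach_eq_singleton hc hmax hω
  have hU := pushBottom_update_of_eq_singleton hT'
  exact ⟨update T' z [], fits_pushBottom_iff.1 (hU.symm ▸ hr.fits hT), hU.symm ▸ hr⟩

theorem stackReach_of_content_eq [Fintype ι] (hT : Fits c T) (hT' : Fits c T')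
    (hTT' : content T = content T') (hc : Roomy c (content T).card) : StackReach c T T' := by
  induction hw : (content T).card generalizing c T T' with
  | zero =>
    have hnil := Multiset.card_eq_zero.1 hw
    rw [eq_nil_of_content_eq_zero hnil, eq_nil_of_content_eq_zero (hTT'.symm.trans hnil)]
  | succ w ih =>
    obtain ⟨ω, hω⟩ := Multiset.card_pos_iff_exists_mem.1 (show 0 < (content T).card by omega)
    obtain ⟨i, hi⟩ := mem_content.1 hω
    have : Nonempty ι := ⟨i⟩
    obtain ⟨z, hz⟩ := Finite.exists_max c
    have hcz : 0 < c z := (List.length_pos_of_mem hi).trans_le ((hT i).trans (hz i))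
    obtain ⟨c, rfl⟩ := exists_eq_add_single hcz
    have hmax (k : ι) : c k ≤ c z + 1 := (Nat.le_add_right _ _).trans (by simpa using hz k)
    obtain ⟨U, hU, hr⟩ := hT.exists_stackReach_pushBottom hc hmax hω
    obtain ⟨U', hU', hr'⟩ := hT'.exists_stackReach_pushBottom (hTT' ▸ hc) hmax (hTT' ▸ hω)
    have hcontent : content T = ω ::ₘ content U := hr.content_eq.trans (content_pushBottom U z ω)
    have hcontent' : content T = ω ::ₘ content U' :=
      hTT'.trans (hr'.content_eq.trans (content_pushBottom U' z ω))
    have hcard : (content U).card = w := by simpa [hcontent] using hw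
    have hUU' : StackReach c U U' :=
      ih hU hU' ((Multiset.cons_inj_right ω).1 (hcontent.symm.trans hcontent'))
        (hcard ▸ (hw ▸ hc).of_add_single hmax) hcard
    exact hr.trans ((hUU'.pushBottom z ω).trans hr'.symm)

end Stacks

variable {W : Type*} {s : ℕ} {h : ℕ} {m : Fin s → ℕ}

/-- The capacities of the stacks of a position: `h` for the headshunt, which is stack `none`, and
`m i` for siding `i`, which is stack `some i`. -/
def capacity (h : ℕ) (m : Fin s → ℕ) (k : Option (Fin s)) : ℕ :=
  k.elim h m

@[simp] theorem capacity_none : capacity h m none = h := rfl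

@[simp] theorem capacity_some (i : Fin s) : capacity h m (some i) = m i := rfl

theorem sum_capacity : ∑ k, capacity h m k = h + ∑ i, m i := by
  simp [Fintype.sum_option]

theorem Fits.capacity_succ {T : Option (Fin s) → List W} (hT : Fits (capacity h m) T) :
    Fits (capacity (h + 1) m) T
  | none => (hT none).trans h.le_succ
  | some i => hT (some i)

theorem roomy_capacity {w : ℕ} (hm : ∀ i, 0 < m i) (hs : (1 < s ∧ 0 < h) ∨ 2 < s)
    (hc : MainCondition w (h + 1) m) : Roomy (capacity h m) w where
  add_le_sum := by
    rw [MainCondition, Nat.add_sub_cancel] at hc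
    rw [sum_capacity]
    rintro (_ | i)
    · rw [capacity_none]
      omega
    · have : m i ≤ Finset.univ.sup m := Finset.le_sup (Finset.mem_univ i)
      rw [capacity_some]
      omega
  two_lt_card _ := by
    have hcard : #{k | 0 < capacity h m k} = (if 0 < capacity h m none then 1 else 0) + s := by
      rw [Finset.card_filter, Fintype.sum_option]
      simp [hm]
    rw [hcard, capacity_none]
    rcases hs with ⟨hs, hh⟩ | hs
    · rw [if_pos hh]
      omega
    · omega

namespace Position

/-- The tracks of a position as stacks with the points at the top; the headshunt is stack `none`,
and as it ends at the points it is reversed. -/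
def toStacks (p : Position W h m) (k : Option (Fin s)) : List W :=
  k.elim p.headshunt.reverse p.siding

@[simp] theorem toStacks_none (p : Position W h m) : p.toStacks none = p.headshunt.reverse := rfl

@[simp] theorem toStacks_some (p : Position W h m) (i : Fin s) :
    p.toStacks (some i) = p.siding i := rfl

theorem toStacks_injective : Injective (toStacks : Position W h m → _) := fun _ _ hpq =>
  Position.ext (List.reverse_injective (congrFun hpq none))
    (funext fun i => congrFun hpq (some i))

theorem fits_toStacks (p : Position W h m) : Fits (capacity h m) p.toStacks
  | none => by simpa using p.headshunt_length_le
  | some i => p.siding_length_le i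

theorem nodup_toStacks (p : Position W h m) : ∀ k, (p.toStacks k).Nodup
  | none => List.nodup_reverse.2 p.headshunt_nodup
  | some i => p.siding_nodup i

theorem exists_mem_toStacks (p : Position W h m) (a : W) : ∃ k, a ∈ p.toStacks k := by
  rcases p.cover a with ha | ⟨i, ha⟩
  · exact ⟨none, List.mem_reverse.2 ha⟩
  · exact ⟨some i, ha⟩

theorem disjoint_toStacks (p : Position W h m) :
    ∀ {k l}, k ≠ l → (p.toStacks k).Disjoint (p.toStacks l)
  | none, none, hkl => (hkl rfl).elim
  | none, some j, _ => List.disjoint_reverse_left.2 (p.headshunt_disjoint j)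
  | some i, none, _ => (List.disjoint_reverse_left.2 (p.headshunt_disjoint i)).symm
  | some i, some j, hkl => p.siding_disjoint i j fun hij => hkl (congrArg some hij)

theorem count_content_toStacks [DecidableEq W] (p : Position W h m) (a : W) :
    (content p.toStacks).count a = 1 := by
  obtain ⟨k, hk⟩ := p.exists_mem_toStacks a
  rw [count_content, Finset.sum_eq_single_of_mem k (Finset.mem_univ k)]
  · exact List.count_eq_one_of_mem (p.nodup_toStacks k) hk
  · exact fun l _ hl => List.count_eq_zero.2 (p.disjoint_toStacks hl.symm hk)

theorem content_toStacks_eq {h' : ℕ} {m' : Fin s → ℕ} (p : Position W h m)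
    (q : Position W h' m') : content p.toStacks = content q.toStacks := by
  classical
  ext a
  rw [count_content_toStacks, count_content_toStacks]

theorem content_toStacks [Fintype W] (p : Position W h m) :
    content p.toStacks = Finset.univ.val := by
  classical
  ext a
  rw [count_content_toStacks, Multiset.count_univ]

theorem card_content_toStacks [Fintype W] (p : Position W h m) :
    (content p.toStacks).card = Fintype.card W := by
  rw [content_toStacks, Finset.card_val, Finset.card_univ]

theorem length_headshunt_add_sum_length_siding [Fintype W] (p : Position W h m) :
    p.headshunt.length + ∑ i, (p.siding i).length = Fintype.card W := by
  simp [← p.card_content_toStacks, card_content, Fintype.sum_option]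

theorem exists_toStacks_eq {h' : ℕ} {m' : Fin s → ℕ} (p : Position W h' m')
    {T : Option (Fin s) → List W} (hT : content T = content p.toStacks)
    (hfits : Fits (capacity h m) T) : ∃ q : Position W h m, q.toStacks = T := by
  classical
  have hcount (a : W) : ∑ k, (T k).count a = 1 := by
    rw [← count_content, hT, p.count_content_toStacks]
  have hnodup (k) : (T k).Nodup := List.nodup_iff_count_le_one.2 fun a =>
    (Finset.single_le_sum (fun k _ => Nat.zero_le ((T k).count a)) (Finset.mem_univ k)).trans
      (hcount a).le
  have hdisj {k l} (hkl : k ≠ l) : (T k).Disjoint (T l) := fun a hk hl => by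
    have hpair := Finset.sum_le_sum_of_subset (f := fun k => (T k).count a)
      (Finset.subset_univ {k, l})
    rw [hcount, Finset.sum_pair hkl] at hpair
    have := List.count_pos_iff.2 hk
    have := List.count_pos_iff.2 hl
    omega
  have hcover (a : W) : ∃ k, a ∈ T k :=
    mem_content.1 (hT ▸ mem_content.2 (p.exists_mem_toStacks a))
  let q : Position W h m :=
    { headshunt := (T none).reverse
      siding := fun i => T (some i)
      headshunt_nodup := List.nodup_reverse.2 (hnodup none)
      siding_nodup := fun i => hnodup (some i)
      cover := fun a => by simpa [Option.exists] using hcover a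
      headshunt_disjoint := fun i =>
        List.disjoint_reverse_left.2 (hdisj (Option.some_ne_none i).symm)
      siding_disjoint := fun i j hij => hdisj (mt Option.some.inj hij)
      headshunt_length_le := by simpa using hfits none
      siding_length_le := fun i => hfits (some i) }
  exact ⟨q, funext fun k => by cases k <;> simp [q]⟩

theorem reachable_of_push_headshunt {p q : Position W h m} {U : Option (Fin s) → List W}
    {k : Option (Fin s)} {a : W} (hp : p.toStacks = push U k a) (hq : q.toStacks = push U none a) :
    (graph W h m).Reachable p q := by
  rcases k with _ | r
  · exact toStacks_injective (hp.trans hq.symm) ▸ .refl _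
  have hpk (k) := congrFun hp k
  have hqk (k) := congrFun hq k
  have hp₀ : p.headshunt = (U none).reverse := by
    simpa [push] using congrArg List.reverse (hpk none)
  have hq₀ : q.headshunt = (U none).reverse ++ [a] := by
    simpa [push] using congrArg List.reverse (hqk none)
  have hpr : p.siding r = a :: U (some r) := by simpa [push] using hpk (some r)
  have hqr : q.siding r = U (some r) := by simpa [push] using hqk (some r)
  refine SimpleGraph.Adj.reachable (show IsMove p q from ⟨?_, r, fun i hi => ?_, ?_⟩)
  · rintro rfl
    simp [hp₀] at hq₀
  · rw [← toStacks_some p, ← toStacks_some q, hp, hq]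
    simp [push, hi]
  · simp [hp₀, hq₀, hpr, hqr]

/-- The wagon `a` travels via the headshunt, which has a vacant place for it. -/
theorem reachable_of_push {p q : Position W (h + 1) m} {U : Option (Fin s) → List W}
    {k l : Option (Fin s)} {a : W} (hp : p.toStacks = push U k a) (hq : q.toStacks = push U l a)
    (hU : (U none).length ≤ h) : (graph W (h + 1) m).Reachable p q := by
  have hcontent : content (push U none a) = content p.toStacks := by
    rw [hp, content_push, content_push]
  have hfits : Fits (capacity (h + 1) m) (push U none a) := by
    rintro (_ | i)
    · simpa [push] using hU
    · have hi := (length_le_length_push U k a (some i)).trans (hp ▸ p.fits_toStacks (some i))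
      simpa [push] using hi
  obtain ⟨r, hr⟩ := p.exists_toStacks_eq hcontent hfits
  exact (reachable_of_push_headshunt hp hr).trans (reachable_of_push_headshunt hq hr).symm

theorem reachable_of_stackStep {p q : Position W (h + 1) m}
    (hstep : StackStep (capacity h m) p.toStacks q.toStacks) :
    (graph W (h + 1) m).Reachable p q := by
  obtain ⟨hfits, -, U, k, l, a, hp, hq⟩ := hstep
  exact reachable_of_push hp hq ((length_le_length_push U k a none).trans (hp ▸ hfits none))

theorem reachable_of_stackReach {p q : Position W (h + 1) m}
    (hr : StackReach (capacity h m) p.toStacks q.toStacks) : (graph W (h + 1) m).Reachable p q := by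
  generalize hT : q.toStacks = T at hr
  induction hr generalizing q with
  | refl => exact toStacks_injective hT ▸ .refl _
  | tail hr hstep ih =>
    obtain ⟨r, rfl⟩ := p.exists_toStacks_eq (h := h + 1) (m := m)
      (StackReach.content_eq hr).symm hstep.1.capacity_succ
    exact (ih rfl).trans (reachable_of_stackStep (hT ▸ hstep))

theorem exists_reachable_fits [Fintype W] (p : Position W (h + 1) m)
    (hw : Fintype.card W ≤ ∑ i, m i) :
    ∃ q : Position W (h + 1) m, (graph W (h + 1) m).Reachable p q ∧
      Fits (capacity h m) q.toStacks := by
  by_cases hp : p.headshunt.length ≤ h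
  · refine ⟨p, .refl p, ?_⟩
    rintro (_ | i)
    · simpa using hp
    · exact p.siding_length_le i
  obtain ⟨r, hr⟩ : ∃ r, (p.siding r).length < m r := by
    by_contra! hfull
    have := Finset.sum_le_sum (s := Finset.univ) fun i _ => hfull i
    have := p.length_headshunt_add_sum_length_siding
    omega
  obtain ⟨a, l, hal⟩ : ∃ a l, p.toStacks none = a :: l :=
    List.exists_cons_of_length_pos (by simp; omega)
  have hl : l.length ≤ h := by simpa [hal] using p.fits_toStacks none
  have hpush := push_update_of_eq_cons hal
  set U := update p.toStacks none l
  have hU (i) : U (some i) = p.siding i := by simp [U]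
  have hfits : Fits (capacity h m) (push U (some r) a) := by
    rintro (_ | i)
    · simpa [push, U] using hl
    · rcases eq_or_ne i r with rfl | hi
      · simpa [push, hU] using hr
      · simpa [push, hU, hi] using p.siding_length_le i
  obtain ⟨q, hq⟩ := p.exists_toStacks_eq (h := h + 1) (m := m)
    (by rw [← hpush, content_push, content_push])
    hfits.capacity_succ
  exact ⟨q, reachable_of_push hpush.symm hq (by simpa [U] using hl), hq ▸ hfits⟩

theorem reachable_of_mainCondition [Fintype W] (hm : ∀ i, 0 < m i)
    (hs : (1 < s ∧ 0 < h) ∨ 2 < s) (hc : MainCondition (Fintype.card W) (h + 1) m)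
    (p q : Position W (h + 1) m) : (graph W (h + 1) m).Reachable p q := by
  have hw : Fintype.card W ≤ ∑ i, m i := by
    rw [MainCondition, Nat.add_sub_cancel] at hc
    omega
  obtain ⟨p', hpp', hp'⟩ := p.exists_reachable_fits hw
  obtain ⟨q', hqq', hq'⟩ := q.exists_reachable_fits hw
  have hr : StackReach (capacity h m) p'.toStacks q'.toStacks :=
    stackReach_of_content_eq hp' hq' (p'.content_toStacks_eq q')
      (p'.card_content_toStacks ▸ roomy_capacity hm hs hc)
  exact hpp'.trans ((reachable_of_stackReach hr).trans hqq'.symm)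

theorem reachable_of_unique [Unique W] (p q : Position W (h + 1) m) :
    (graph W (h + 1) m).Reachable p q := by
  obtain ⟨k, hk⟩ := exists_eq_push_of_content_eq_singleton p.content_toStacks
  obtain ⟨l, hl⟩ := exists_eq_push_of_content_eq_singleton q.content_toStacks
  exact reachable_of_push hk hl h.zero_le

end Position

/-- `e` singles out a wagon of each position that is the same before and after any move, in a way
compatible with permutations of the wagons. Invariants of this kind are the obstructions to solving
the puzzle. -/
structure IsWagonInvariant (e : Position W h m → Option W) : Prop where
  isSome : ∀ p, (e p).isSome
  eq_of_isMove : ∀ {p q}, IsMove p q → e p = e q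
  permute : ∀ (σ : Equiv.Perm W) (p), e (p.permute σ) = (e p).map σ

namespace IsWagonInvariant

variable {e : Position W h m → Option W} {S F : Set (Position W h m)}

theorem eq_of_reachable (he : IsWagonInvariant e) {p q : Position W h m}
    (hr : (graph W h m).Reachable p q) : e p = e q := by
  rw [SimpleGraph.reachable_iff_reflTransGen] at hr
  induction hr with
  | refl => rfl
  | tail _ hadj ih => exact ih.trans (he.eq_of_isMove hadj)

theorem exists_mem_eq_some (he : IsWagonInvariant e) (hS : S.Nonempty) (hSnat : IsNaturalStart S)
    (hsol : AlwaysSolvable S F) (b : W) : ∃ q ∈ F, e q = some b := by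
  classical
  obtain ⟨p, hp⟩ := hS
  obtain ⟨a, ha⟩ := Option.isSome_iff_exists.1 (he.isSome p)
  obtain ⟨q, hq, hr⟩ := hsol _ (hSnat p hp (Equiv.swap a b))
  exact ⟨q, hq, by
    rw [← he.eq_of_reachable hr, he.permute, ha, Option.map_some, Equiv.swap_apply_left]⟩

theorem not_alwaysSolvable_of_forall_eq [Nontrivial W] (he : IsWagonInvariant e)
    (hS : S.Nonempty) (hSnat : IsNaturalStart S) {ω : W} (hF : ∀ q ∈ F, e q = some ω) :
    ¬ AlwaysSolvable S F := fun hsol => by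
  obtain ⟨b, hb⟩ := exists_ne ω
  obtain ⟨q, hq, hqb⟩ := he.exists_mem_eq_some hS hSnat hsol b
  exact hb (Option.some.inj (hqb.symm.trans (hF q hq)))

theorem not_alwaysSolvable_of_forall_ne (he : IsWagonInvariant e) (hS : S.Nonempty)
    (hSnat : IsNaturalStart S) {ω : W} (hF : ∀ q ∈ F, e q ≠ some ω) : ¬ AlwaysSolvable S F :=
  fun hsol =>
    let ⟨q, hq, hqω⟩ := he.exists_mem_eq_some hS hSnat hsol ω
    hF q hq hqω

end IsWagonInvariant

namespace Position

theorem headshunt_ne_nil_of_sum_lt [Fintype W] (hlt : ∑ i, m i < Fintype.card W)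
    (p : Position W h m) : p.headshunt ≠ [] := fun hp => by
  have hle := Finset.sum_le_sum (s := Finset.univ) fun i _ => p.siding_length_le i
  have hlen := p.length_headshunt_add_sum_length_siding
  rw [hp, List.length_nil] at hlen
  omega

theorem length_headshunt_of_siding_eq_nil [Fintype W] {j : Fin s}
    (hle : h + ∑ i, m i ≤ Fintype.card W + m j) (p : Position W h m) (hp : p.siding j = []) :
    p.headshunt.length = h := by
  have hlen := p.length_headshunt_add_sum_length_siding
  rw [← Finset.add_sum_erase _ _ (Finset.mem_univ j), hp, List.length_nil] at hlen
  rw [← Finset.add_sum_erase _ m (Finset.mem_univ j)] at hle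
  have := Finset.sum_le_sum (s := Finset.univ.erase j) fun i _ => p.siding_length_le i
  have := p.headshunt_length_le
  omega

theorem reverse_headshunt (hh : h ≤ 1) (p : Position W h m) :
    p.headshunt.reverse = p.headshunt := by
  have hlen := p.headshunt_length_le.trans hh
  match p.headshunt, hlen with
  | [], _ => rfl
  | [_], _ => rfl

end Position

theorem IsMove.length_headshunt_ne {p q : Position W h m} (hpq : IsMove p q) :
    p.headshunt.length ≠ q.headshunt.length := fun hlen => by
  obtain ⟨hne, r, hi, hr⟩ := hpq
  obtain ⟨h₀, hr⟩ := List.append_inj hr hlen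
  refine hne (Position.ext h₀ (funext fun i => ?_))
  rcases eq_or_ne i r with rfl | hir
  · exact hr
  · exact hi i hir

theorem isWagonInvariant_head?_headshunt [Fintype W] (hlt : ∑ i, m i < Fintype.card W) :
    IsWagonInvariant fun p : Position W h m => p.headshunt.head? where
  isSome p := List.isSome_head?.2 (p.headshunt_ne_nil_of_sum_lt hlt)
  eq_of_isMove {p q} := fun ⟨_, _, _, hr⟩ => by
    rw [← List.head?_append_of_ne_nil _ (p.headshunt_ne_nil_of_sum_lt hlt), hr,
      List.head?_append_of_ne_nil _ (q.headshunt_ne_nil_of_sum_lt hlt)]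
  permute σ p := List.head?_map

theorem isWagonInvariant_getLast?_headshunt_append_siding [Fintype W] (hh : 0 < h) {j : Fin s}
    (hle : h + ∑ i, m i ≤ Fintype.card W + m j) :
    IsWagonInvariant fun p : Position W h m => (p.headshunt ++ p.siding j).getLast? where
  isSome p := by
    rw [List.getLast?_isSome]
    intro hnil
    obtain ⟨h₀, hj⟩ := List.append_eq_nil_iff.1 hnil
    have := p.length_headshunt_of_siding_eq_nil hle hj
    rw [h₀, List.length_nil] at this
    omega
  eq_of_isMove {p q} hpq := by
    have ⟨_, r, hi, hr⟩ := hpq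
    rcases eq_or_ne j r with rfl | hjr
    · rw [hr]
    have hj : p.siding j ≠ [] := fun hj => hpq.length_headshunt_ne <|
      (p.length_headshunt_of_siding_eq_nil hle hj).trans
        (q.length_headshunt_of_siding_eq_nil hle (hi j hjr ▸ hj)).symm
    rw [List.getLast?_append_of_ne_nil _ hj, hi j hjr,
      List.getLast?_append_of_ne_nil _ (hi j hjr ▸ hj)]
  permute σ p := by simp only [Position.permute, ← List.map_append, List.getLast?_map]

theorem isWagonInvariant_getLast?_of_forall_eq [Nonempty W] {z : Fin s} (hz : ∀ i, i = z) :
    IsWagonInvariant fun p : Position W h m => (p.headshunt ++ p.siding z).getLast? where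
  isSome p := by
    obtain ⟨a⟩ := ‹Nonempty W›
    refine List.getLast?_isSome.2 (List.ne_nil_of_mem (a := a) (List.mem_append.2 ?_))
    exact (p.cover a).imp_right fun ⟨i, hi⟩ => hz i ▸ hi
  eq_of_isMove := fun ⟨_, r, _, hr⟩ => by rw [← hz r, hr]
  permute σ p := by simp only [Position.permute, ← List.map_append, List.getLast?_map]

/-- The two sidings, joined end to end through the headshunt, form a single track along which the
order of the wagons never changes. -/
theorem isWagonInvariant_getLast?_of_forall_eq_or_eq [Nonempty W] (hh : h ≤ 1) {y z : Fin s}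
    (hyz : y ≠ z) (hs : ∀ i, i = y ∨ i = z) :
    IsWagonInvariant fun p : Position W h m =>
      ((p.siding y).reverse ++ p.headshunt ++ p.siding z).getLast? where
  isSome p := by
    obtain ⟨a⟩ := ‹Nonempty W›
    refine List.getLast?_isSome.2 (List.ne_nil_of_mem (a := a) ?_)
    rw [List.mem_append, List.mem_append, List.mem_reverse]
    rcases p.cover a with ha | ⟨i, ha⟩
    · exact Or.inl (Or.inr ha)
    · rcases hs i with rfl | rfl
      · exact Or.inl (Or.inl ha)
      · exact Or.inr ha
  eq_of_isMove {p q} := fun ⟨_, r, hi, hr⟩ => by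
    rcases hs r with rfl | rfl
    · rw [← p.reverse_headshunt hh, ← q.reverse_headshunt hh, ← List.reverse_append,
        ← List.reverse_append, hr, hi z hyz.symm]
    · rw [List.append_assoc, hr, hi y hyz, List.append_assoc]
  permute σ p := by
    simp only [Position.permute, ← List.map_append, ← List.map_reverse, List.getLast?_map]

section Necessity

variable {S F : Set (Position W h m)}

theorem AlwaysSolvable.card_le_sum [Fintype W] (hsol : AlwaysSolvable S F) (hS : S.Nonempty)
    (hSnat : IsNaturalStart S) (hFnat : IsNaturalFinish F) : Fintype.card W ≤ ∑ i, m i := by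
  obtain ⟨z, ω, hF⟩ := hFnat
  by_contra! hlt
  exact (isWagonInvariant_head?_headshunt hlt).not_alwaysSolvable_of_forall_ne hS hSnat
    (fun q hq hω => q.headshunt_disjoint z (List.mem_of_mem_head? hω)
      (List.mem_of_getLast? (hF q hq))) hsol

variable [Nontrivial W] (hsol : AlwaysSolvable S F) (hS : S.Nonempty) (hSnat : IsNaturalStart S)
  (hFnat : IsNaturalFinish F)

include hsol hS hSnat hFnat

theorem AlwaysSolvable.card_add_lt [Fintype W] (hh : 0 < h) (j : Fin s) :
    Fintype.card W + m j < h + ∑ i, m i := by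
  obtain ⟨z, ω, hF⟩ := hFnat
  by_contra! hle
  have he := isWagonInvariant_getLast?_headshunt_append_siding hh hle
  rcases eq_or_ne z j with rfl | hzj
  · refine he.not_alwaysSolvable_of_forall_eq hS hSnat (ω := ω) (fun q hq => ?_) hsol
    rw [List.getLast?_append, hF q hq, Option.some_or]
  · refine he.not_alwaysSolvable_of_forall_ne hS hSnat (ω := ω) (fun q hq hω => ?_) hsol
    have hz := List.mem_of_getLast? (hF q hq)
    rcases List.mem_append.1 (List.mem_of_getLast? hω) with h₀ | hj
    · exact q.headshunt_disjoint z h₀ hz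
    · exact q.siding_disjoint z j hzj hz hj

theorem AlwaysSolvable.mainCondition [Fintype W] (hs : 0 < s) (hh : 0 < h) :
    MainCondition (Fintype.card W) h m := by
  have : Nonempty (Fin s) := ⟨⟨0, hs⟩⟩
  obtain ⟨j, -, hj⟩ := Finset.exists_mem_eq_sup Finset.univ Finset.univ_nonempty m
  have := hsol.card_le_sum hS hSnat hFnat
  have := hsol.card_add_lt hS hSnat hFnat hh j
  rw [MainCondition, hj]
  omega

theorem AlwaysSolvable.one_lt_or_two_lt : (1 < s ∧ 1 < h) ∨ 2 < s := by
  obtain ⟨z, ω, hF⟩ := hFnat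
  by_contra! hcon
  by_cases hz : ∀ i, i = z
  · refine (isWagonInvariant_getLast?_of_forall_eq hz).not_alwaysSolvable_of_forall_eq hS hSnat
      (ω := ω) (fun q hq => ?_) hsol
    rw [List.getLast?_append, hF q hq, Option.some_or]
  · obtain ⟨y, hyz⟩ := not_forall.1 hz
    refine (isWagonInvariant_getLast?_of_forall_eq_or_eq (by omega) hyz
      (by omega)).not_alwaysSolvable_of_forall_eq hS hSnat (ω := ω) (fun q hq => ?_) hsol
    rw [List.getLast?_append, hF q hq, Option.some_or]

end Necessity

end Inglenook

theorem mainTheorem1 {W : Type*} [Fintype W] (w s h : ℕ) (m : Fin s → ℕ)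
    (hW : Fintype.card W = w) (hw : 0 < w) (hs : 0 < s) (hh : 0 < h) (hm : ∀ i, 0 < m i)
    (hlt : w < h + ∑ i, m i)
    (S F : Set (Inglenook.Position W h m)) (hS : S.Nonempty) (hF : F.Nonempty)
    (hSnat : Inglenook.IsNaturalStart S) (hFnat : Inglenook.IsNaturalFinish F) :
    Inglenook.AlwaysSolvable S F ↔
      w = 1 ∨
      (1 < w ∧ 1 < s ∧ 1 < h ∧ Inglenook.MainCondition w h m) ∨
      (1 < w ∧ 2 < s ∧ h = 1 ∧ Inglenook.MainCondition w h m) := by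
  subst hW
  constructor
  · intro hsol
    refine (Nat.succ_le_of_lt hw).eq_or_lt.imp Eq.symm fun h1 => ?_
    have : Nontrivial W := Fintype.one_lt_card_iff_nontrivial.1 h1
    have hc := hsol.mainCondition hS hSnat hFnat hs hh
    have hs' := hsol.one_lt_or_two_lt hS hSnat hFnat
    simp only [h1, hc, true_and, and_true]
    omega
  · intro hcond p _
    obtain ⟨q, hq⟩ := hF
    refine ⟨q, hq, ?_⟩
    obtain ⟨h, rfl⟩ := Nat.exists_eq_add_one.2 hh
    rcases hcond with h1 | ⟨-, hs, hh, hc⟩ | ⟨-, hs, -, hc⟩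
    · obtain ⟨_⟩ := Fintype.card_eq_one_iff_nonempty_unique.1 h1
      exact p.reachable_of_unique q
    · exact p.reachable_of_mainCondition hm (Or.inl ⟨hs, by omega⟩) hc q
    · exact p.reachable_of_mainCondition hm (Or.inr hs) hc q
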